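/- All graphs are finite, simple and undirected. For a graph $G=(V,E)$, $N(v)$ is the set of neighbours of a vertex $v$, $N[v]=N(v)\cup\{v\}$, and $d(u,v)$ is the number of edges of a shortest $uv$-path. A \emph{module} of $G$ is a set $M\subseteq V$ such that $N(x)\setminus M=N(y)\setminus M$ for all $x,y\in M$; $G$ is \emph{prime} if its only modules are $\emptyset$, $V$ and the singletons $\{v\}$, $v\in V$. A vertex $v$ is an \emph{extremity} if $G\setminus N[v]$ is connected. For pairwise distinct and nonadjacent vertices $x,y,u$, write $x\perp_y u$ if $x$ and $u$ lie in different connected components of $G\setminus N[y]$. A set $S\subseteq V$ is \emph{$u$-transitive} if, for all nonadjacent $x\in S$ and $y\in V$, $x\perp_y u$ implies $y\in S$. \textbf{Lemma.} There is an algorithm which, given (the adjacency lists of) a prime graph $G=(V,E)$ with $n=|V|\ge 3$ vertices and $m=|E|$ edges, a vertex $u\in V$ and a $u$-transitive set $S\subseteq V$ such that $V\ne S\cup N[u]$, computes in linear time, that is, in $O(n+m)$ steps of a unit-cost RAM, an extremity $v\notin S\cup N[u]$ of $G$ such that $d(u,v)=\max\{d(u,w) : w\in V\setminus (S\cup N[u])\}$.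 -/

import Mathlib

/-! ### Graph notions -/

namespace SimpleGraph

variable {V : Type*} (G : SimpleGraph V)

/-- The closed neighbourhood `N[v]` of a vertex. -/
def closedNbhd (v : V) : Set V := insert v (G.neighborSet v)

/-- A module: any two of its vertices have the same neighbours outside of it. -/
def IsModuleSet (M : Set V) : Prop :=
  ∀ x ∈ M, ∀ y ∈ M, G.neighborSet x \ M = G.neighborSet y \ M

/-- A graph is prime if its only modules are the empty set, the whole vertex set and the
singletons. -/
def IsPrimeGraph : Prop :=
  ∀ M : Set V, G.IsModuleSet M → M = ∅ ∨ M = Set.univ ∨ ∃ v, M = {v}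

/-- `v` is an extremity if removing its closed neighbourhood leaves the graph connected (the graph
without vertices counts as connected; this plays no role for a vertex `v` outside of some `N[u]`,
since then `u` remains). -/
def IsExtremity (v : V) : Prop := (G.induce (G.closedNbhd v)ᶜ).Preconnected

/-- `G.Separates w u v` is the relation `u ⊥_w v`: the vertices `u`, `v`, `w` are pairwise distinct
and nonadjacent, and `u`, `v` lie in different connected components of `G \ N[w]`. -/
def Separates (w u v : V) : Prop :=
  (u ≠ v ∧ u ≠ w ∧ v ≠ w) ∧ (¬ G.Adj u v ∧ ¬ G.Adj u w ∧ ¬ G.Adj v w) ∧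
    ∃ (hu : u ∈ (G.closedNbhd w)ᶜ) (hv : v ∈ (G.closedNbhd w)ᶜ),
      ¬ (G.induce (G.closedNbhd w)ᶜ).Reachable ⟨u, hu⟩ ⟨v, hv⟩

/-- `S` is `u`-transitive: for nonadjacent `x ∈ S` and `y`, if `x ⊥_y u` then `y ∈ S`. -/
def IsTransitiveSet (u : V) (S : Set V) : Prop :=
  ∀ x ∈ S, ∀ y : V, ¬ G.Adj x y → G.Separates y x u → y ∈ S

end SimpleGraph

/-! ### Random access machine programs, with unit cost

A program uses finitely many registers and finitely many arrays, all holding natural numbers. An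
array cell is accessed through an index held in a register. The arithmetic is limited to successor
and predecessor: in `t` steps no stored number can exceed the maximum of the initial contents and
of the constants of the program by more than `t`. In a computation that takes linear time on an
input made of numbers of linear size, all numbers therefore have logarithmically many bits, and
charging one unit per operation is the usual word RAM convention. -/

namespace Ram

/-- The memory: `reg x` is the content of register `x`, and `arr a i` that of cell `i` of
array `a`. -/
structure Mem where
  reg : ℕ → ℕ
  arr : ℕ → ℕ → ℕ

/-- Comparisons of two registers. -/
inductive Test where
  | eq (x y : ℕ)
  | ne (x y : ℕ)
  | lt (x y : ℕ)
  | le (x y : ℕ)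

/-- The truth of a comparison. -/
def Test.Holds : Test → Mem → Prop
  | .eq x y, s => s.reg x = s.reg y
  | .ne x y, s => s.reg x ≠ s.reg y
  | .lt x y, s => s.reg x < s.reg y
  | .le x y, s => s.reg x ≤ s.reg y

/-- Elementary operations. -/
inductive Op where
  /-- `x := c` -/
  | const (x c : ℕ)
  /-- `x := y` -/
  | copy (x y : ℕ)
  /-- `x := y + 1` -/
  | succ (x y : ℕ)
  /-- `x := y - 1` (and `0` if `y` is `0`) -/
  | pred (x y : ℕ)
  /-- `x := a[y]` -/
  | load (x a y : ℕ)
  /-- `a[y] := x` -/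
  | store (a y x : ℕ)

/-- Writing a register. -/
def Mem.setReg (s : Mem) (x k : ℕ) : Mem := { s with reg := Function.update s.reg x k }

/-- Writing an array cell. -/
def Mem.setArr (s : Mem) (a i k : ℕ) : Mem :=
  { s with arr := Function.update s.arr a (Function.update (s.arr a) i k) }

/-- The effect of an elementary operation. -/
def Op.apply : Op → Mem → Mem
  | .const x c, s => s.setReg x c
  | .copy x y, s => s.setReg x (s.reg y)
  | .succ x y, s => s.setReg x (s.reg y + 1)
  | .pred x y, s => s.setReg x (s.reg y - 1)
  | .load x a y, s => s.setReg x (s.arr a (s.reg y))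
  | .store a y x, s => s.setArr a (s.reg y) (s.reg x)

/-- Programs. -/
inductive Prog where
  | op (o : Op)
  | seq (p q : Prog)
  | ite (b : Test) (p q : Prog)
  | loop (b : Test) (p : Prog)

/-- `Exec p s s' t`: the program `p`, started in memory `s`, halts in memory `s'` after exactly `t`
steps, where each elementary operation and each evaluation of a test is one step. -/
inductive Exec : Prog → Mem → Mem → ℕ → Prop
  | op (o : Op) (s : Mem) : Exec (.op o) s (o.apply s) 1
  | seq {p q : Prog} {s s' s'' : Mem} {t t' : ℕ} :
      Exec p s s' t → Exec q s' s'' t' → Exec (.seq p q) s s'' (t + t')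
  | ite_true {b : Test} {p q : Prog} {s s' : Mem} {t : ℕ} :
      b.Holds s → Exec p s s' t → Exec (.ite b p q) s s' (1 + t)
  | ite_false {b : Test} {p q : Prog} {s s' : Mem} {t : ℕ} :
      ¬ b.Holds s → Exec q s s' t → Exec (.ite b p q) s s' (1 + t)
  | loop_done {b : Test} {p : Prog} {s : Mem} :
      ¬ b.Holds s → Exec (.loop b p) s s 1
  | loop_step {b : Test} {p : Prog} {s s' s'' : Mem} {t t' : ℕ} :
      b.Holds s → Exec p s s' t → Exec (.loop b p) s' s'' t' →
        Exec (.loop b p) s s'' (1 + t + t')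

/-- Programs are deterministic: the final memory and the number of steps are unique. -/
theorem Exec.unique {p : Prog} {s s₁ s₂ : Mem} {t₁ t₂ : ℕ} (h₁ : Exec p s s₁ t₁)
    (h₂ : Exec p s s₂ t₂) : s₁ = s₂ ∧ t₁ = t₂ := by
  induction h₁ generalizing s₂ t₂ with
  | op o s => cases h₂; exact ⟨rfl, rfl⟩
  | seq _ _ ih ih' =>
    cases h₂ with
    | seq a b =>
      obtain ⟨rfl, rfl⟩ := ih a
      obtain ⟨rfl, rfl⟩ := ih' b
      exact ⟨rfl, rfl⟩
  | ite_true hb _ ih =>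
    cases h₂ with
    | ite_true _ a => obtain ⟨rfl, rfl⟩ := ih a; exact ⟨rfl, rfl⟩
    | ite_false hb' _ => exact absurd hb hb'
  | ite_false hb _ ih =>
    cases h₂ with
    | ite_true hb' _ => exact absurd hb' hb
    | ite_false _ a => obtain ⟨rfl, rfl⟩ := ih a; exact ⟨rfl, rfl⟩
  | loop_done hb =>
    cases h₂ with
    | loop_done _ => exact ⟨rfl, rfl⟩
    | loop_step hb' _ _ => exact absurd hb' hb
  | loop_step hb _ _ ih ih' =>
    cases h₂ with
    | loop_done hb' => exact absurd hb hb'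
    | loop_step _ a b =>
      obtain ⟨rfl, rfl⟩ := ih a
      obtain ⟨rfl, rfl⟩ := ih' b
      exact ⟨rfl, rfl⟩

/-! ### The input: a graph given by adjacency lists, a vertex and a set of vertices -/

/-- `L` is an adjacency list representation of `G`: for each vertex `v`, the list `L v` contains
every neighbour of `v` exactly once, in an arbitrary order, and nothing else. -/
def IsAdjLists {n : ℕ} (G : SimpleGraph (Fin n)) (L : Fin n → List (Fin n)) : Prop :=
  ∀ v, (L v).Nodup ∧ ∀ w, w ∈ L v ↔ G.Adj v w

open Classical in
/-- The initial memory. Register `0` holds the number `n` of vertices and register `1` the vertex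
`u`. Array `1` holds the adjacency lists, one after the other; the list of vertex `v` occupies its
cells from number `arr 0 v` (included) to number `arr 0 (v + 1)` (excluded). Array `2` holds the
characteristic function of `S`. Everything else is `0`. -/
noncomputable def input {n : ℕ} (L : Fin n → List (Fin n)) (u : Fin n) (S : Set (Fin n)) : Mem where
  reg
    | 0 => n
    | 1 => u
    | _ => 0
  arr
    | 0 => fun i => if i ≤ n then (((List.finRange n).take i).flatMap L).length else 0
    | 1 => fun k => ((((List.finRange n).flatMap L)[k]?).map Fin.val).getD 0
    | 2 => fun i => if ∃ h : i < n, (⟨i, h⟩ : Fin n) ∈ S then 1 else 0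
    | _ => fun _ => 0

end Ram

/-! The algorithm keeps a nonempty set X of candidates (mark 0), initially the vertices outside S
other than u, and processes the other vertices through a queue that starts with u. Processing p
deletes N(p) from X unless this would empty X, that is, unless X ⊆ N(p). In both cases p ends up
adjacent to all of X or to none of it, and this persists as X shrinks. The neighbours of p outside X
are then queued. Once every vertex outside X has been processed, X is a nonempty module avoiding u,
so by primality X = {v} (`SearchInv.exists_unique`).

That v is an extremity comes from a second invariant: if w ∈ X and N[w] separates x from u, then x ∈
X. It holds initially by u-transitivity, and deleting N(p) preserves it because p, being outside X,
cannot itself be separated from u by N[w] (`SearchInv.visit`). For X = {v} it says that N[v]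
separates nothing from u (`SearchInv.isExtremity`).

As for the distance, until the first p with X ⊆ N(p) the search is a breadth-first search from u. At
that p, of distance ℓ say, all of X lies at distance ℓ + 1, and no vertex outside S ∪ N[u] is
farther (`BreadthFirst.visit`). From then on X only shrinks, so the order of processing no longer
matters.

Time is linear because comparing |X ∩ N(p)| with |X| costs one pass over the list of p, and each
vertex is processed at most once per search. -/

namespace Ram

/-! ### Rules for time-bounded execution -/

/-- `p`, started in `s`, halts within `T` steps in a memory that satisfies `Q`. -/
def Halts (p : Prog) (s : Mem) (T : ℕ) (Q : Mem → Prop) : Prop :=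
  ∃ s' t, Exec p s s' t ∧ t ≤ T ∧ Q s'

theorem Halts.op {o : Op} {s : Mem} {Q : Mem → Prop} (h : Q (o.apply s)) :
    Halts (.op o) s 1 Q := ⟨_, _, .op o s, le_rfl, h⟩

theorem Halts.mono {p : Prog} {s : Mem} {T T' : ℕ} {Q Q' : Mem → Prop} (h : Halts p s T Q)
    (hT : T ≤ T') (hQ : ∀ s', Q s' → Q' s') : Halts p s T' Q' := by
  obtain ⟨s', t, h1, h2, h3⟩ := h
  exact ⟨s', t, h1, h2.trans hT, hQ _ h3⟩

theorem Halts.seq {p q : Prog} {s : Mem} {T T' : ℕ} {Q : Mem → Prop}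
    (h : Halts p s T (fun s' => Halts q s' T' Q)) : Halts (.seq p q) s (T + T') Q := by
  obtain ⟨s', t, h1, h2, s'', t', h3, h4, h5⟩ := h
  exact ⟨s'', _, .seq h1 h3, by omega, h5⟩

theorem Halts.op_seq {o : Op} {q : Prog} {s : Mem} {T : ℕ} {Q : Mem → Prop}
    (h : Halts q (o.apply s) T Q) : Halts (.seq (.op o) q) s (T + 1) Q :=
  (Halts.seq (Halts.op h)).mono (by omega) fun _ h => h

theorem Halts.ite {b : Test} {p q : Prog} {s : Mem} {T : ℕ} {Q : Mem → Prop}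
    (h : b.Holds s → Halts p s T Q) (h' : ¬ b.Holds s → Halts q s T Q) :
    Halts (.ite b p q) s (T + 1) Q := by
  by_cases hb : b.Holds s
  · obtain ⟨s', t, h1, h2, h3⟩ := h hb
    exact ⟨s', _, .ite_true hb h1, by omega, h3⟩
  · obtain ⟨s', t, h1, h2, h3⟩ := h' hb
    exact ⟨s', _, .ite_false hb h1, by omega, h3⟩

theorem Halts.loop_done {b : Test} {p : Prog} {s : Mem} {T : ℕ} {Q : Mem → Prop}
    (hb : ¬ b.Holds s) (h : Q s) : Halts (.loop b p) s (T + 1) Q :=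
  ⟨_, _, .loop_done hb, by omega, h⟩

theorem Halts.loop_step {b : Test} {p : Prog} {s : Mem} {T T' : ℕ} {Q : Mem → Prop}
    (hb : b.Holds s) (h : Halts p s T (fun s' => Halts (.loop b p) s' T' Q)) :
    Halts (.loop b p) s (T + 1 + T') Q := by
  obtain ⟨s', t, h1, h2, s'', t', h3, h4, h5⟩ := h
  exact ⟨s'', _, .loop_step hb h1 h3, by omega, h5⟩

/-! ### The working state, its layout in memory, and the elementary operations -/

variable {n : ℕ}

/-- The working state of the search: a mark for each vertex, the queue, and two counters. -/
structure State (n : ℕ) where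
  mark : Fin n → ℕ
  queue : List (Fin n)
  size : ℕ
  count : ℕ

/-- The beginning of the adjacency list of vertex `i` in the concatenation of all lists. -/
def offset (L : Fin n → List (Fin n)) (i : ℕ) : ℕ := (((List.finRange n).take i).flatMap L).length

/-- The memory `s` contains the adjacency lists `L` and the working state `a`. -/
structure Rep (L : Fin n → List (Fin n)) (a : State n) (s : Mem) : Prop where
  reg_zero : s.reg 0 = n
  reg_const_zero : s.reg 11 = 0
  reg_const_one : s.reg 12 = 1
  reg_const_two : s.reg 13 = 2
  offset : ∀ i ≤ n, s.arr 0 i = Ram.offset L i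
  adj : ∀ k, s.arr 1 k = ((((List.finRange n).flatMap L)[k]?).map Fin.val).getD 0
  mark : ∀ v : Fin n, s.arr 2 v = a.mark v
  queue : ∀ i (h : i < a.queue.length), s.arr 4 i = a.queue[i]
  length : s.reg 3 = a.queue.length
  size : s.reg 4 = a.size
  count : s.reg 5 = a.count

/-- `B` performs the operation `f` on the working state, for the vertex in register `9`, in at
most `T` steps, and does not change the registers which control the loops. -/
def Implements (L : Fin n → List (Fin n)) (B : Prog) (f : State n → Fin n → State n) (T : ℕ) :
    Prop :=
  ∀ a s (q : Fin n), Rep L a s → s.reg 9 = q →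
    Halts B s T fun s' => Rep L (f a q) s' ∧
      s'.reg 2 = s.reg 2 ∧ s'.reg 6 = s.reg 6 ∧ s'.reg 7 = s.reg 7 ∧ s'.reg 8 = s.reg 8 ∧
      s'.reg 9 = s.reg 9

/-- Execute `B` for all vertices in register `9`. -/
def forVertices (B : Prog) : Prog :=
  .seq (.op (.const 9 0)) (.loop (.lt 9 0) (.seq B (.op (.succ 9 9))))

/-- Execute `B` for all neighbours of the vertex in register `6`, in register `9`. -/
def forNeighbours (B : Prog) : Prog :=
  .seq (.op (.load 7 0 6)) <| .seq (.op (.succ 8 6)) <| .seq (.op (.load 8 0 8)) <|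
    .loop (.lt 7 8) (.seq (.op (.load 9 1 7)) (.seq (.op (.succ 7 7)) B))

/-- Count the vertices with mark `0`. -/
def countOp : Prog :=
  -- Copying register 5 to itself serves as the empty instruction, here and below.
  .seq (.op (.load 10 2 9)) (.ite (.eq 10 11) (.op (.succ 5 5)) (.op (.copy 5 5)))

/-- Change mark `0` into `1`. -/
def removeOp : Prog :=
  .seq (.op (.load 10 2 9)) (.ite (.eq 10 11)
    (.seq (.op (.store 2 9 12)) (.op (.pred 4 4))) (.op (.copy 5 5)))

/-- Put a vertex with mark `1` on the queue, with mark `2`. -/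
def pushOp : Prog :=
  .seq (.op (.load 10 2 9)) (.ite (.eq 10 12)
    (.seq (.op (.store 2 9 13)) (.seq (.op (.store 4 3 9)) (.op (.succ 3 3))))
    (.op (.copy 5 5)))

def State.countStep (a : State n) (q : Fin n) : State n :=
  if a.mark q = 0 then { a with count := a.count + 1 } else a

def State.removeStep (a : State n) (q : Fin n) : State n :=
  if a.mark q = 0 then { a with mark := Function.update a.mark q 1, size := a.size - 1 } else a

def State.pushStep (a : State n) (q : Fin n) : State n :=
  if a.mark q = 1 then { a with mark := Function.update a.mark q 2, queue := a.queue ++ [q] }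
  else a

theorem implements_count (L : Fin n → List (Fin n)) :
    Implements L countOp State.countStep 3 := by
  intro a s q h hq
  refine .op_seq (.ite (fun hb => .op ?_) fun hb => .op ?_) <;>
  simp [Test.Holds, Op.apply, Mem.setReg, hq, h.mark, h.reg_const_zero] at hb <;>
  constructor <;> simp [Op.apply, Mem.setReg, State.countStep, hb] <;>
  constructor <;> simp [h.reg_zero, h.reg_const_zero, h.reg_const_one, h.reg_const_two,
    h.adj, h.mark, h.length, h.size, h.count] <;>
  first | exact h.offset | exact h.queue

theorem implements_remove (L : Fin n → List (Fin n)) :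
    Implements L removeOp State.removeStep 4 := by
  intro a s q h hq
  refine .op_seq (.ite (fun hb => .op_seq (.op ?_)) fun hb => (Halts.op ?_).mono (by omega)
    fun _ h => h) <;>
  simp [Test.Holds, Op.apply, Mem.setReg, hq, h.mark, h.reg_const_zero] at hb <;>
  constructor <;> simp [Op.apply, Mem.setReg, Mem.setArr, State.removeStep, hb] <;>
  constructor <;> simp [h.reg_zero, h.reg_const_zero, h.reg_const_one, h.reg_const_two,
    h.adj, h.mark, h.length, h.size, h.count, hq, Function.update_apply, Fin.ext_iff] <;>
  first | exact h.offset | exact h.queue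

theorem implements_push (L : Fin n → List (Fin n)) :
    Implements L pushOp State.pushStep 5 := by
  intro a s q h hq
  refine .op_seq (.ite (fun hb => .op_seq (.op_seq (.op ?_))) fun hb =>
    (Halts.op ?_).mono (by omega) fun _ h => h) <;>
  simp [Test.Holds, Op.apply, Mem.setReg, hq, h.mark, h.reg_const_one] at hb <;>
  constructor <;> simp [Op.apply, Mem.setReg, Mem.setArr, State.pushStep, hb] <;>
  constructor <;> simp [h.reg_zero, h.reg_const_zero, h.reg_const_one, h.reg_const_two,
    h.adj, h.mark, h.length, h.size, h.count, hq, Function.update_apply, Fin.ext_iff]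
  any_goals first | exact h.offset | exact h.queue
  intro i hi
  split_ifs with h1
  · subst h1; simp
  · rw [List.getElem_append_left (by omega)]; exact h.queue i (by omega)

theorem Rep.setReg {L : Fin n → List (Fin n)} {a : State n} {s : Mem} (h : Rep L a s)
    (r k : ℕ) (hr : r ∉ [0, 3, 4, 5, 11, 12, 13]) : Rep L a (s.setReg r k) := by
  simp at hr
  obtain ⟨h0, h3, h4, h5, h6, h7, h8⟩ := hr
  constructor <;> simp [Mem.setReg, Function.update_of_ne, Ne.symm, *, h.reg_zero,
    h.reg_const_zero, h.reg_const_one, h.reg_const_two, h.adj, h.mark, h.length,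
    h.size, h.count]
  exacts [h.offset, h.queue]

/-! ### Loops over all vertices and over adjacency lists -/

theorem Implements.forVertices_aux {L : Fin n → List (Fin n)} {B : Prog}
    {f : State n → Fin n → State n} {T : ℕ} (hB : Implements L B f T) (j : ℕ) :
    ∀ a s, Rep L a s → s.reg 9 + j = n →
      Halts (.loop (.lt 9 0) (.seq B (.op (.succ 9 9)))) s ((T + 2) * j + 1) fun s' =>
        Rep L (((List.finRange n).drop (n - j)).foldl f a) s' ∧
        s'.reg 2 = s.reg 2 := by
  induction j with
  | zero =>
    intro a s h hj
    refine .loop_done ?_ ?_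
    · simp [Test.Holds, h.reg_zero]; omega
    · simpa [List.drop_of_length_le] using h
  | succ j ih =>
    intro a s h hj
    have hlt : s.reg 9 < n := by omega
    have e : (List.finRange n).drop (n - (j + 1)) =
        ⟨s.reg 9, hlt⟩ :: (List.finRange n).drop (n - j) := by
      rw [List.drop_eq_getElem_cons (by simp; omega)]
      congr 1
      · simp; omega
      · congr 1; omega
    refine (Halts.loop_step (T := T + 1) (T' := (T + 2) * j + 1) ?_ (.seq
      ((hB a s ⟨s.reg 9, hlt⟩ h rfl).mono le_rfl ?_))).mono (by ring_nf; omega) fun _ h => h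
    · simp [Test.Holds, h.reg_zero, hlt]
    · rintro s' ⟨h1, h2, -, -, -, h3⟩
      refine .op ((ih _ _ (h1.setReg 9 _ (by simp)) ?_).mono le_rfl ?_)
      · simp [Mem.setReg, h3]; omega
      · rintro s'' ⟨h4, h5⟩
        rw [e]
        refine ⟨h4, ?_⟩
        rw [h5, ← h2]; simp [Mem.setReg]

theorem Implements.forVertices {L : Fin n → List (Fin n)} {B : Prog}
    {f : State n → Fin n → State n} {T : ℕ} (hB : Implements L B f T) {a : State n} {s : Mem}
    (h : Rep L a s) :
    Halts (forVertices B) s ((T + 2) * n + 2) fun s' =>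
      Rep L ((List.finRange n).foldl f a) s' ∧ s'.reg 2 = s.reg 2 := by
  refine .op_seq ((hB.forVertices_aux n a _ (h.setReg 9 0 (by simp)) ?_).mono le_rfl ?_)
  · simp [Mem.setReg]
  · rintro s' ⟨h1, h2⟩
    refine ⟨by simpa using h1, ?_⟩
    rw [h2]; simp [Mem.setReg]

theorem Implements.forNeighbours_aux {L : Fin n → List (Fin n)} {B : Prog}
    {f : State n → Fin n → State n} {T : ℕ} (hB : Implements L B f T) (l : List (Fin n)) :
    ∀ a s, Rep L a s → (∀ j (h : j < l.length), s.arr 1 (s.reg 7 + j) = l[j]) →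
      s.reg 8 = s.reg 7 + l.length →
      Halts (.loop (.lt 7 8) (.seq (.op (.load 9 1 7)) (.seq (.op (.succ 7 7)) B))) s
        ((T + 3) * l.length + 1) fun s' =>
        Rep L (l.foldl f a) s' ∧ s'.reg 2 = s.reg 2 ∧ s'.reg 6 = s.reg 6 := by
  induction l with
  | nil =>
    intro a s h _ h8
    exact .loop_done (by simp [Test.Holds, h8]) (by simpa using h)
  | cons q l ih =>
    intro a s h hl h8
    have hq : s.arr 1 (s.reg 7) = q := hl 0 (by simp)
    have key := hB a (Op.apply (.succ 7 7) (Op.apply (.load 9 1 7) s)) q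
      ((h.setReg 9 _ (by simp)).setReg 7 _ (by simp)) (by simp [Op.apply, Mem.setReg, hq])
    refine (Halts.loop_step (T := T + 2) (T' := (T + 3) * l.length + 1) ?_ (.op_seq (.op_seq
      (key.mono le_rfl ?_)))).mono (by simp; ring_nf; omega) fun _ h => h
    · simp [Test.Holds, h8]
    · rintro s' ⟨h1, h2, h6, h7, h8', -⟩
      simp [Op.apply, Mem.setReg] at h2 h6 h7 h8'
      refine (ih _ s' h1 ?_ ?_).mono le_rfl ?_
      · intro j hj
        have := hl (j + 1) (by simpa using hj)
        rw [h1.adj, ← h.adj, h7, show s.reg 7 + 1 + j = s.reg 7 + (j + 1) by ring, this]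
        simp
      · simp at h8; omega
      · rintro s'' ⟨k1, k2, k6⟩
        exact ⟨k1, k2.trans h2, k6.trans h6⟩

theorem Implements.forNeighbours {L : Fin n → List (Fin n)} {B : Prog}
    {f : State n → Fin n → State n} {T : ℕ} (hB : Implements L B f T) {a : State n} {s : Mem}
    (h : Rep L a s) {p : Fin n} (hp : s.reg 6 = p) :
    Halts (forNeighbours B) s ((T + 3) * (L p).length + 4) fun s' =>
      Rep L ((L p).foldl f a) s' ∧ s'.reg 2 = s.reg 2 ∧ s'.reg 6 = s.reg 6 := by
  have e : (List.finRange n).take (p + 1) = (List.finRange n).take p ++ [p] := by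
    rw [List.take_succ_eq_append_getElem (by simp)]; simp
  have e' : List.finRange n = (List.finRange n).take p ++ p :: (List.finRange n).drop (p + 1) := by
    conv_lhs => rw [← List.take_append_drop (p + 1) (List.finRange n), e]
    simp
  have ho := h.offset p p.2.le
  have ho' := h.offset (p + 1) p.2
  rw [offset] at ho
  rw [offset, e] at ho'
  simp only [List.flatMap_append, List.length_append, List.flatMap_singleton] at ho'
  refine .op_seq (.op_seq (.op_seq ((hB.forNeighbours_aux (L p) a _
    (((h.setReg 7 _ (by simp)).setReg 8 _ (by simp)).setReg 8 _ (by simp)) ?_ ?_).mono le_rfl ?_)))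
  · intro j hj
    simp only [Op.apply, Mem.setReg]
    simp [hp]
    rw [h.adj, ho, e']
    simp only [List.flatMap_append, List.flatMap_cons]
    rw [← e', List.getElem?_append_right (by omega), List.getElem?_append_left (by omega)]
    simp [hj]
  · simp [Op.apply, Mem.setReg, hp, ho, ho']
  · rintro s' ⟨h1, h2, h6⟩
    refine ⟨h1, ?_, ?_⟩
    · rw [h2]; simp [Op.apply, Mem.setReg]
    · rw [h6]; simp [Op.apply, Mem.setReg]

end Ram

/-! ### Closed forms of the loops, and the program -/

namespace Ram
variable {n : ℕ}

/-- Store the vertex in the counter if it has mark `0`. -/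
def findOp : Prog :=
  .seq (.op (.load 10 2 9)) (.ite (.eq 10 11) (.op (.copy 5 9)) (.op (.copy 5 5)))

def State.findStep (a : State n) (q : Fin n) : State n :=
  if a.mark q = 0 then { a with count := q } else a

theorem implements_find (L : Fin n → List (Fin n)) :
    Implements L findOp State.findStep 3 := by
  intro a s q h hq
  refine .op_seq (.ite (fun hb => .op ?_) fun hb => .op ?_) <;>
  simp [Test.Holds, Op.apply, Mem.setReg, hq, h.mark, h.reg_const_zero] at hb <;>
  constructor <;> simp [Op.apply, Mem.setReg, State.findStep, hb] <;>
  constructor <;> simp [h.reg_zero, h.reg_const_zero, h.reg_const_one, h.reg_const_two,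
    h.adj, h.mark, h.length, h.size, h.count, hq] <;>
  first | exact h.offset | exact h.queue

theorem foldl_countStep (l : List (Fin n)) (a : State n) :
    l.foldl State.countStep a = { a with count := a.count + l.countP (a.mark · = 0) } := by
  induction l generalizing a with
  | nil => rfl
  | cons q l ih =>
    rw [List.foldl_cons, ih, State.countStep]
    split_ifs with h <;> simp [h]
    omega

/-- Without repetitions in `l`, each candidate in it is counted once, so `size` drops by exactly the
number of candidates removed. -/
theorem foldl_removeStep {l : List (Fin n)} (hl : l.Nodup) (a : State n) :
    l.foldl State.removeStep a =
      { a with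
        mark := fun v => if v ∈ l ∧ a.mark v = 0 then 1 else a.mark v
        size := a.size - l.countP (a.mark · = 0) } := by
  induction l generalizing a with
  | nil => simp
  | cons q l ih =>
    rw [List.nodup_cons] at hl
    rw [List.foldl_cons, ih hl.2, State.removeStep]
    split_ifs with h
    · have e : l.countP (Function.update a.mark q 1 · = 0) = l.countP (a.mark · = 0) := by
        apply List.countP_congr
        intro v hv
        rw [Function.update_of_ne (by rintro rfl; exact hl.1 hv)]
      simp only [e, State.mk.injEq, true_and, and_true]
      constructor
      · ext v
        by_cases hv : v = q
        · subst hv; simp [h]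
        · simp [hv]
      · simp [h]; omega
    · simp only [State.mk.injEq, true_and, and_true]
      constructor
      · ext v
        by_cases hv : v = q
        · subst hv; simp [h]
        · simp [hv]
      · simp [h]

theorem foldl_pushStep {l : List (Fin n)} (hl : l.Nodup) (a : State n) :
    l.foldl State.pushStep a =
      { a with
        mark := fun v => if v ∈ l ∧ a.mark v = 1 then 2 else a.mark v
        queue := a.queue ++ l.filter (a.mark · = 1) } := by
  induction l generalizing a with
  | nil => simp
  | cons q l ih =>
    rw [List.nodup_cons] at hl
    rw [List.foldl_cons, ih hl.2, State.pushStep]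
    split_ifs with h
    · have e : l.filter (Function.update a.mark q 2 · = 1) = l.filter (a.mark · = 1) := by
        apply List.filter_congr
        intro v hv
        rw [Function.update_of_ne (by rintro rfl; exact hl.1 hv)]
      simp only [e, State.mk.injEq, and_true]
      constructor
      · ext v
        by_cases hv : v = q
        · subst hv; simp [h]
        · simp [hv]
      · simp [h]
    · simp only [State.mk.injEq, and_true]
      constructor
      · ext v
        by_cases hv : v = q
        · subst hv; simp [h]
        · simp [hv]
      · simp [h]

theorem foldl_findStep {l : List (Fin n)} (a : State n) {v : Fin n} (hv : v ∈ l)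
    (h : ∀ w, a.mark w = 0 ↔ w = v) : (l.foldl State.findStep a).count = v := by
  -- The induction needs the weaker premise that `v` is either still ahead or already recorded.
  have key : ∀ (l : List (Fin n)) (a : State n), (∀ w, a.mark w = 0 ↔ w = v) →
      (v ∈ l ∨ a.count = v) → (l.foldl State.findStep a).count = v := by
    intro l
    induction l with
    | nil => intro a _ h; simpa using h
    | cons q l ih =>
      intro a ha hm
      rw [List.foldl_cons, State.findStep]
      split_ifs with hq
      · exact ih _ ha (.inr (by simp [(ha q).1 hq]))
      · refine ih _ ha ?_
        have : v ≠ q := fun e => hq ((ha q).2 e.symm)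
        simpa [this] using hm
  exact key l a h (.inl hv)

/-- Remove the mark `0` from the vertices of `l` if fewer than `a.size` of them have it. -/
def State.prune (a : State n) (l : List (Fin n)) : State n :=
  if a.count < a.size then l.foldl State.removeStep a else a

/-- Process a vertex with the list of neighbours `l`: unless all vertices with mark `0` are in `l`,
those in `l` lose their mark `0`; then the vertices of `l` with mark `1` are put on the queue. -/
def State.visit (a : State n) (l : List (Fin n)) : State n :=
  l.foldl State.pushStep ((l.foldl State.countStep { a with count := 0 }).prune l)

/-- Register 2 is the head of the queue. The test compares the number of candidates in the list
(register 5) with the number of all candidates (register 4). -/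
def visitProg : Prog :=
  .seq (.op (.load 6 4 2)) <| .seq (.op (.succ 2 2)) <| .seq (.op (.const 5 0)) <|
    .seq (forNeighbours countOp) <|
    .seq (.ite (.lt 5 4) (forNeighbours removeOp) (.op (.copy 5 5))) (forNeighbours pushOp)

theorem halts_visitProg {L : Fin n → List (Fin n)} {a : State n} {s : Mem} (h : Rep L a s)
    (hlt : s.reg 2 < a.queue.length) :
    Halts visitProg s (21 * (L a.queue[s.reg 2]).length + 16) fun s' =>
      Rep L (a.visit (L a.queue[s.reg 2])) s' ∧ s'.reg 2 = s.reg 2 + 1 := by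
  have hq := h.queue _ hlt
  set p := a.queue[s.reg 2]
  have h0 : Rep L { a with count := 0 } (((s.setReg 6 p).setReg 2 (s.reg 2 + 1)).setReg 5 0) := by
    constructor <;> simp [Mem.setReg, h.reg_zero, h.reg_const_zero, h.reg_const_one,
      h.reg_const_two, h.adj, h.mark, h.length, h.size] <;>
    first | exact h.offset | exact h.queue
  -- Counting, removing and pushing cost 3, 4 and 5, plus 3 per iteration for the loop: 6 + 7 + 8 =
  -- 21 per neighbour.
  refine (Halts.op_seq (.op_seq (.op_seq (.seq (((implements_count L).forNeighbours (p := p)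
    (a := { a with count := 0 }) ?_ ?_).mono le_rfl ?_))))
    (T := (6 * (L p).length + 4) + ((7 * (L p).length + 4 + 1) + (8 * (L p).length + 4)) + 1 + 1)).mono
    (by omega) fun _ h => h
  · simpa [Op.apply, hq, Mem.setReg] using h0
  · simp [Op.apply, hq, Mem.setReg]
  rintro s₁ ⟨h1, h12, h16⟩
  simp [Op.apply, Mem.setReg, hq] at h12 h16
  refine .seq ((Halts.ite (Q := fun s' => 
    Rep L (((L p).foldl State.countStep { a with count := 0 }).prune (L p)) s' ∧
      s'.reg 2 = s.reg 2 + 1 ∧ s'.reg 6 = p) (fun hb => ?_) fun hb => ?_).mono le_rfl ?_)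
  · simp only [Test.Holds, h1.count, h1.size] at hb
    refine ((implements_remove L).forNeighbours h1 h16).mono le_rfl ?_
    rintro s' ⟨h2, h3, h4⟩
    simp only [State.prune, hb, if_true]
    exact ⟨h2, h3.trans h12, h4.trans h16⟩
  · simp only [Test.Holds, h1.count, h1.size] at hb
    refine (Halts.op (Q := fun s' => s' = s₁) ?_).mono (by omega) ?_
    · simp [Op.apply, Mem.setReg]
    · rintro _ rfl
      simp only [State.prune, hb, if_false]
      exact ⟨h1, h12, h16⟩
  · rintro s₂ ⟨h2, h22, h26⟩
    refine ((implements_push L).forNeighbours h2 h26).mono le_rfl ?_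
    rintro s' ⟨h3, h4, -⟩
    exact ⟨h3, h4.trans h22⟩

/-- Process the queue. -/
def searchProg : Prog := .loop (.lt 2 3) visitProg

/-- `J` is a loop invariant and `Φ` a potential that pays for each visit; the 17 is the 16 of the
visit plus the loop test. -/
theorem halts_searchProg {L : Fin n → List (Fin n)} (J : State n → ℕ → Prop)
    (Φ : State n → ℕ → ℕ)
    (hJ : ∀ a h, J a h → ∀ hlt : h < a.queue.length, J (a.visit (L a.queue[h])) (h + 1) ∧
      21 * (L a.queue[h]).length + 17 + Φ (a.visit (L a.queue[h])) (h + 1) ≤ Φ a h)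
    (N : ℕ) : ∀ {a : State n} {s : Mem}, Rep L a s → J a (s.reg 2) → Φ a (s.reg 2) ≤ N →
    Halts searchProg s (N + 1) fun s' =>
      ∃ a', Rep L a' s' ∧ J a' (s'.reg 2) ∧ a'.queue.length ≤ s'.reg 2 := by
  induction N using Nat.strong_induction_on with
  | _ N ih =>
    intro a s h hj hN
    by_cases hlt : s.reg 2 < a.queue.length
    · obtain ⟨h1, h2⟩ := hJ a _ hj hlt
      refine (Halts.loop_step (T' := N - (21 * (L a.queue[s.reg 2]).length + 17) + 1)
        (by simpa [Test.Holds, h.length] using hlt) ((halts_visitProg h hlt).mono le_rfl ?_)).mono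
          (by omega) fun _ h => h
      rintro s' ⟨h3, h4⟩
      rw [← h4] at h1 h2
      exact ih _ (by omega) h3 h1 (by omega)
    · exact .loop_done (by simpa [Test.Holds, h.length] using hlt) ⟨a, h, hj, by omega⟩

/-- Array 2 already marks S with 1 and register 11 is 0 from the start. Two searches are needed: a
vertex of S reachable from u only through candidates is never queued by the first, and keeps mark 1
until the pass of `pushOp` over all vertices. -/
def mainProg : Prog :=
  .seq (.op (.const 12 1)) <| .seq (.op (.const 13 2)) <| .seq (.op (.store 2 1 13)) <|
  .seq (.op (.store 4 3 1)) <| .seq (.op (.succ 3 3)) <| .seq (forVertices countOp) <|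
  .seq (.op (.copy 4 5)) <| .seq searchProg <| .seq (forVertices pushOp) <|
  .seq searchProg <| .seq (forVertices findOp) (.op (.copy 0 5))

open Classical in
/-- The working state at the beginning. -/
noncomputable def State.init (u : Fin n) (S : Set (Fin n)) : State n where
  mark v := if v = u then 2 else if v ∈ S then 1 else 0
  queue := [u]
  size := 0
  count := 0

theorem rep_init (L : Fin n → List (Fin n)) (u : Fin n) (S : Set (Fin n)) :
    Rep L (State.init u S) (Op.apply (.succ 3 3) <| Op.apply (.store 4 3 1) <|
      Op.apply (.store 2 1 13) <| Op.apply (.const 13 2) <| Op.apply (.const 12 1) <|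
      input L u S) := by
  constructor <;> simp [Op.apply, Mem.setReg, Mem.setArr, input, State.init]
  · intro i hi; simp [hi, offset]
  · intro v
    have e : (∃ h : (v : ℕ) < n, (⟨v, h⟩ : Fin n) ∈ S) ↔ v ∈ S := ⟨fun h => h.2, fun h => ⟨v.2, h⟩⟩
    simp only [Function.update_apply, Fin.ext_iff]
    classical exact if_congr Iff.rfl rfl (if_congr e rfl rfl)

end Ram

/-! ### Separated vertices, connectedness of prime graphs, distances -/

namespace SimpleGraph

variable {V : Type*} {G : SimpleGraph V}

/-- `x` is hidden from `u` by `w` if `u` and `x` lie in different connected components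
of `G \ N[w]`. -/
def Hidden (G : SimpleGraph V) (u w x : V) : Prop :=
  ∃ (hx : x ∈ (G.closedNbhd w)ᶜ) (hu : u ∈ (G.closedNbhd w)ᶜ),
    ¬ (G.induce (G.closedNbhd w)ᶜ).Reachable ⟨x, hx⟩ ⟨u, hu⟩

theorem notMem_closedNbhd {w x : V} : x ∉ G.closedNbhd w ↔ x ≠ w ∧ ¬ G.Adj w x := by
  simp [closedNbhd]

theorem Hidden.of_adj {u w x p : V} (h : G.Hidden u w x) (hp : G.Adj p x)
    (hpw : p ∉ G.closedNbhd w) : G.Hidden u w p := by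
  obtain ⟨hx, hu, h⟩ := h
  refine ⟨hpw, hu, fun h' => h (Reachable.trans (Adj.reachable ?_) h')⟩
  exact hp.symm

theorem Hidden.ne {u w x : V} (h : G.Hidden u w x) : x ≠ u := by
  rintro rfl
  obtain ⟨hx, hu, h⟩ := h
  exact h (Reachable.refl _)

theorem Hidden.separates {u w x : V} (h : G.Hidden u w x) : G.Separates w x u := by
  have hne := h.ne
  obtain ⟨hx, hu, h⟩ := h
  have hx' := notMem_closedNbhd.1 hx
  have hu' := notMem_closedNbhd.1 hu
  refine ⟨⟨hne, hx'.1, hu'.1⟩, ⟨fun hadj => h ?_, fun h => hx'.2 h.symm, fun h => hu'.2 h.symm⟩,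
    hx, hu, h⟩
  exact Adj.reachable (show (G.induce _).Adj _ _ from hadj)

/-- This is u-transitivity in contrapositive form, the initial case of the invariant
`SearchInv.closed`. -/
theorem IsTransitiveSet.notMem_of_hidden {u w x : V} {S : Set V} (hS : G.IsTransitiveSet u S)
    (h : G.Hidden u w x) (hw : w ∉ S) : x ∉ S := fun hx =>
  hw (hS x hx w h.separates.2.1.2.1 h.separates)

theorem mem_of_preconnected (hG : G.Preconnected) {A : Set V} {u : V} (hu : u ∈ A)
    (hA : ∀ p ∈ A, ∀ q, G.Adj p q → q ∈ A) (v : V) : v ∈ A := by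
  have := (reachable_iff_reflTransGen u v).1 (hG u v)
  induction this with
  | refl => exact hu
  | tail _ h ih => exact hA _ ih _ h

/-- A connected component is a module, so in a disconnected prime graph every component is a point.
The complement of an isolated vertex is then a module with at least two elements, a contradiction.
-/
theorem IsPrimeGraph.preconnected [Finite V] (hG : G.IsPrimeGraph) (hV : 3 ≤ Nat.card V) :
    G.Preconnected := by
  have : Fintype V := Fintype.ofFinite V
  by_contra hcon
  obtain ⟨u, v, huv⟩ : ∃ u v, ¬ G.Reachable u v := by simpa [Preconnected] using hcon
  have iso : ∀ u v, ¬ G.Reachable u v → ∀ w, ¬ G.Adj u w := by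
    intro u v huv w hw
    have hm : G.IsModuleSet {x | G.Reachable u x} := by
      intro x hx y hy
      ext z
      simp only [Set.mem_sdiff, mem_neighborSet, Set.mem_ofPred_eq]
      exact ⟨fun h => absurd (Reachable.trans hx h.1.reachable) h.2,
        fun h => absurd (Reachable.trans hy h.1.reachable) h.2⟩
    rcases hG _ hm with h | h | ⟨y, h⟩
    · exact Set.eq_empty_iff_forall_notMem.1 h u (Reachable.refl u)
    · exact huv (Set.eq_univ_iff_forall.1 h v)
    · have h1 : u = y := by
        have : u ∈ {x | G.Reachable u x} := Reachable.refl u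
        rwa [h] at this
      have h2 : w = y := by
        have : w ∈ {x | G.Reachable u x} := hw.reachable
        rwa [h] at this
      exact hw.ne (h1.trans h2.symm)
  have hu := iso u v huv
  have hm : G.IsModuleSet {u}ᶜ := by
    intro x hx y hy
    ext z
    simp only [Set.mem_sdiff, mem_neighborSet, Set.mem_compl_iff, Set.mem_singleton_iff, not_not]
    constructor <;> rintro ⟨h, rfl⟩ <;> exact absurd h.symm (hu _)
  rcases hG _ hm with h | h | ⟨y, h⟩
  · have : v ∈ ({u}ᶜ : Set V) := fun e => huv (e ▸ Reachable.refl _)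
    rw [h] at this; exact this
  · exact Set.eq_univ_iff_forall.1 h u rfl
  · have h1 := congrArg Set.ncard h
    rw [Set.ncard_compl, Set.ncard_singleton, Set.ncard_singleton] at h1
    omega

theorem exists_adj_dist_eq {u v : V} {k : ℕ} (h : G.dist u v = k + 1) :
    ∃ w, G.Adj w v ∧ G.dist u w = k := by
  have hr : G.Reachable u v := Reachable.of_dist_ne_zero (by omega)
  obtain ⟨p, hp⟩ := hr.symm.exists_walk_length_eq_dist
  rw [dist_comm, h] at hp
  cases p with
  | nil => simp at hp
  | @cons _ w _ hadj p =>
    refine ⟨w, hadj.symm, ?_⟩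
    simp at hp
    have h1 : G.dist w u ≤ k := hp ▸ dist_le p
    have h2 : G.dist v u ≤ G.dist w u + 1 := by
      obtain ⟨q, hq⟩ := (Walk.reachable p).exists_walk_length_eq_dist
      rw [← hq]
      exact dist_le (Walk.cons hadj q)
    rw [dist_comm] at h
    rw [dist_comm]
    omega

theorem Adj.dist_le_succ (hG : G.Preconnected) {u p q : V} (h : G.Adj p q) :
    G.dist u q ≤ G.dist u p + 1 := by
  obtain ⟨w, hw⟩ := (hG u p).exists_walk_length_eq_dist
  rw [← hw]
  exact (dist_le (w.concat h)).trans (by simp)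

end SimpleGraph

/-! ### Invariants of the search -/

namespace Ram
open SimpleGraph
variable {n : ℕ} {G : SimpleGraph (Fin n)} {L : Fin n → List (Fin n)} {u : Fin n}
  {S : Set (Fin n)} {a : State n} {h : ℕ}

/-- The invariant of the search, when `h` vertices have been processed. -/
structure SearchInv (G : SimpleGraph (Fin n)) (u : Fin n) (a : State n) (h : ℕ) : Prop where
  le : h ≤ a.queue.length
  nodup : a.queue.Nodup
  mem_queue : ∀ v, v ∈ a.queue ↔ a.mark v = 2
  mark_le : ∀ v, a.mark v ≤ 2
  size : a.size = (Finset.univ.filter (a.mark · = 0)).card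
  nonempty : ∃ w, a.mark w = 0
  closed : ∀ w, a.mark w = 0 → ∀ x, G.Hidden u w x → a.mark x = 0
  uniform : ∀ p ∈ a.queue.take h,
    (∀ w, a.mark w = 0 → G.Adj p w) ∨ ∀ w, a.mark w = 0 → ¬ G.Adj p w

/-- All candidates are vertices of maximum distance to `u`. -/
def Far (G : SimpleGraph (Fin n)) (u : Fin n) (S : Set (Fin n)) (a : State n) : Prop :=
  ∀ x, a.mark x = 0 → x ∉ S ∪ G.closedNbhd u ∧
    ∀ w, w ∉ S ∪ G.closedNbhd u → G.dist u w ≤ G.dist u x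

/-- The search is still a breadth-first search. -/
structure BreadthFirst (G : SimpleGraph (Fin n)) (u : Fin n) (S : Set (Fin n)) (a : State n)
    (h ℓ : ℕ) : Prop where
  mem_queue : ∀ v, G.dist u v ≤ ℓ → v ∈ a.queue
  le_dist : ∀ v ∈ a.queue.drop h, ℓ ≤ G.dist u v
  dist_le : ∀ v ∈ a.queue, G.dist u v ≤ ℓ + 1
  sorted : (a.queue.drop h).Pairwise (G.dist u · ≤ G.dist u ·)
  adj : ∀ p ∈ a.queue.take h, ∀ q, G.Adj p q → q ∈ a.queue
  removed : ∀ w, w ∉ S → a.mark w ≠ 0 → w ∈ a.queue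
  notMem : ∀ w, a.mark w = 0 → w ∉ S

/-- This is the meaning of the test made by the program: it succeeds iff deleting N(p) leaves a
candidate. -/
theorem IsAdjLists.countP_lt_iff (hL : IsAdjLists G L) {m : Fin n → ℕ} (p : Fin n) :
    (L p).countP (m · = 0) < (Finset.univ.filter (m · = 0)).card ↔
      ∃ w, m w = 0 ∧ ¬ G.Adj p w := by
  have e : (L p).countP (m · = 0) =
      ((Finset.univ.filter (m · = 0)).filter (· ∈ L p)).card := by
    rw [List.countP_eq_length_filter, ← List.toFinset_card_of_nodup ((hL p).1.filter _)]
    congr 1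
    ext v
    simp [and_comm]
  constructor
  · intro hlt
    by_contra hcon
    push Not at hcon
    rw [e, Finset.filter_true_of_mem] at hlt
    · exact hlt.false
    · intro w hw
      exact ((hL p).2 w).2 (hcon w (by simpa using hw))
  · rintro ⟨w, hw, hpw⟩
    rw [e]
    refine Finset.card_lt_card (Finset.filter_ssubset.2 ⟨w, by simpa using hw, ?_⟩)
    rwa [(hL p).2]

theorem visit_of_forall (hL : IsAdjLists G L) (hs : a.size = (Finset.univ.filter
    (a.mark · = 0)).card) (p : Fin n) (hp : ∀ w, a.mark w = 0 → G.Adj p w) :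
    (∀ v, (a.visit (L p)).mark v = if v ∈ L p ∧ a.mark v = 1 then 2 else a.mark v) ∧
    (a.visit (L p)).queue = a.queue ++ (L p).filter (a.mark · = 1) ∧
    (a.visit (L p)).size = a.size := by
  have hc : ¬ (L p).countP (a.mark · = 0) < a.size := by
    rw [hs, hL.countP_lt_iff]
    push Not
    exact hp
  simp only [State.visit, State.prune, foldl_countStep, zero_add, hc, if_false,
    foldl_pushStep (hL p).1]
  simp

/-- Removal turns mark 0 into 1 and pushing turns 1 into 2, so all neighbours of p end up on the
queue. -/
theorem visit_of_exists (hL : IsAdjLists G L) (hs : a.size = (Finset.univ.filter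
    (a.mark · = 0)).card) (ha : ∀ v, a.mark v ≤ 2) (p : Fin n)
    (hp : ∃ w, a.mark w = 0 ∧ ¬ G.Adj p w) :
    (∀ v, (a.visit (L p)).mark v = if v ∈ L p then 2 else a.mark v) ∧
    (a.visit (L p)).queue = a.queue ++ (L p).filter (a.mark · ≠ 2) ∧
    (a.visit (L p)).size = a.size - (L p).countP (a.mark · = 0) := by
  have hc : (L p).countP (a.mark · = 0) < a.size := by
    rwa [hs, hL.countP_lt_iff]
  simp only [State.visit, State.prune, foldl_countStep, zero_add, hc, if_true,
    foldl_removeStep (hL p).1, foldl_pushStep (hL p).1]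
  refine ⟨fun v => ?_, ?_, trivial⟩
  · have := ha v
    by_cases hv : v ∈ L p <;> simp [hv]
    split_ifs <;> omega
  · congr 1
    apply List.filter_congr
    intro v hv
    have := ha v
    simp only [hv, true_and, decide_eq_decide]
    split_ifs <;> omega

theorem SearchInv.getElem_notMem_take (H : SearchInv G u a h) (hlt : h < a.queue.length) :
    a.queue[h] ∉ a.queue.take h := by
  intro hm
  obtain ⟨i, hi, he⟩ := List.mem_take_iff_getElem.1 hm
  have := (H.nodup.getElem_inj_iff).1 he
  omega

theorem SearchInv.mark_visit_eq_zero (hL : IsAdjLists G L) (H : SearchInv G u a h) (p v : Fin n) :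
    (a.visit (L p)).mark v = 0 ↔
      a.mark v = 0 ∧ ((∀ w, a.mark w = 0 → G.Adj p w) ∨ ¬ G.Adj p v) := by
  by_cases hp : ∀ w, a.mark w = 0 → G.Adj p w
  · rw [(visit_of_forall hL H.size p hp).1]
    refine Iff.trans ?_ (and_iff_left (.inl hp)).symm
    split_ifs with hv <;> simp [hv]
  · rw [(visit_of_exists hL H.size H.mark_le p (by simpa using hp)).1]
    rw [or_iff_right hp, ← (hL p).2]
    split_ifs with hv <;> simp [hv]

theorem SearchInv.mark_visit_eq_two (hL : IsAdjLists G L) (H : SearchInv G u a h) (p : Fin n)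
    {v : Fin n} (hv : a.mark v = 2) : (a.visit (L p)).mark v = 2 := by
  by_cases hp : ∀ w, a.mark w = 0 → G.Adj p w
  · rw [(visit_of_forall hL H.size p hp).1, hv]; simp
  · rw [(visit_of_exists hL H.size H.mark_le p (by simpa using hp)).1, hv]; simp

theorem SearchInv.mark_visit_ne_one (hL : IsAdjLists G L) (H : SearchInv G u a h) (p : Fin n)
    (h1 : ∀ v, a.mark v ≠ 1) (v : Fin n) : (a.visit (L p)).mark v ≠ 1 := by
  by_cases hp : ∀ w, a.mark w = 0 → G.Adj p w
  · rw [(visit_of_forall hL H.size p hp).1]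
    split_ifs <;> simp [h1 v]
  · rw [(visit_of_exists hL H.size H.mark_le p (by simpa using hp)).1]
    split_ifs <;> simp [h1 v]

theorem take_visit (hL : IsAdjLists G L) (H : SearchInv G u a h) (hlt : h < a.queue.length) :
    (a.visit (L a.queue[h])).queue.take (h + 1) = a.queue.take h ++ [a.queue[h]] := by
  obtain ⟨l, hl⟩ : ∃ l, (a.visit (L a.queue[h])).queue = a.queue ++ l := by
    by_cases hp : ∀ w, a.mark w = 0 → G.Adj a.queue[h] w
    · exact ⟨_, (visit_of_forall hL H.size _ hp).2.1⟩
    · exact ⟨_, (visit_of_exists hL H.size H.mark_le _ (by simpa using hp)).2.1⟩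
  rw [hl, List.take_append_of_le_length (by omega), List.take_succ_eq_append_getElem hlt]

theorem SearchInv.visit (hL : IsAdjLists G L) (H : SearchInv G u a h)
    (hlt : h < a.queue.length) : SearchInv G u (a.visit (L a.queue[h])) (h + 1) := by
  have hz := H.mark_visit_eq_zero hL a.queue[h]
  have htake := take_visit hL H hlt
  have hp2 : a.mark a.queue[h] = 2 := (H.mem_queue _).1 (List.getElem_mem hlt)
  set p := a.queue[h]
  have hclosed : ∀ w, (a.visit (L p)).mark w = 0 → ∀ x, G.Hidden u w x →
      (a.visit (L p)).mark x = 0 := by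
    intro w hw x hx
    rw [hz] at hw ⊢
    have hx0 := H.closed w hw.1 x hx
    refine ⟨hx0, hw.2.imp_right fun hpw hpx => ?_⟩
    -- A vertex p adjacent to x and outside N[w] lies in the component of x, so it is hidden by w as
    -- well and would be a candidate; but p has mark 2.
    have := H.closed w hw.1 p (hx.of_adj hpx (notMem_closedNbhd.2 ⟨?_, fun h => hpw h.symm⟩))
    · omega
    · intro e; rw [e] at hp2; omega
  have huniform : ∀ q ∈ (a.visit (L p)).queue.take (h + 1),
      (∀ w, (a.visit (L p)).mark w = 0 → G.Adj q w) ∨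
        ∀ w, (a.visit (L p)).mark w = 0 → ¬ G.Adj q w := by
    intro q hq
    rw [htake, List.mem_append, List.mem_singleton] at hq
    rcases hq with hq | rfl
    · exact (H.uniform q hq).imp (fun h w hw => h w ((hz w).1 hw).1)
        fun h w hw => h w ((hz w).1 hw).1
    · by_cases hp : ∀ w, a.mark w = 0 → G.Adj p w
      · exact .inl fun w hw => hp w ((hz w).1 hw).1
      · exact .inr fun w hw => ((hz w).1 hw).2.resolve_left hp
  by_cases hp : ∀ w, a.mark w = 0 → G.Adj p w
  · obtain ⟨h1, h2, h3⟩ := visit_of_forall hL H.size p hp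
    refine ⟨?_, ?_, fun v => ?_, fun v => ?_, ?_, ?_, hclosed, huniform⟩
    · rw [h2, List.length_append]; omega
    · rw [h2]
      refine H.nodup.append ((hL p).1.filter _) fun v hv hv' => ?_
      have := (H.mem_queue v).1 hv
      simp at hv'
      omega
    · rw [h1, h2, List.mem_append, H.mem_queue, List.mem_filter]
      by_cases hv : v ∈ L p ∧ a.mark v = 1 <;> simp [hv]
    · rw [h1]; have := H.mark_le v; split_ifs <;> omega
    · rw [h3, H.size]
      congr 1
      exact Finset.filter_congr fun v _ => ((hz v).trans (and_iff_left (.inl hp))).symm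
    · obtain ⟨w, hw⟩ := H.nonempty
      exact ⟨w, (hz w).2 ⟨hw, .inl hp⟩⟩
  · have hp' : ∃ w, a.mark w = 0 ∧ ¬ G.Adj p w := by simpa using hp
    obtain ⟨h1, h2, h3⟩ := visit_of_exists hL H.size H.mark_le p hp'
    refine ⟨?_, ?_, fun v => ?_, fun v => ?_, ?_, ?_, hclosed, huniform⟩
    · rw [h2, List.length_append]; omega
    · rw [h2]
      refine H.nodup.append ((hL p).1.filter _) fun v hv hv' => ?_
      have := (H.mem_queue v).1 hv
      simp at hv'
      omega
    · rw [h1, h2, List.mem_append, H.mem_queue, List.mem_filter]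
      by_cases hv : v ∈ L p <;> simp [hv]
      exact em _
    · rw [h1]; have := H.mark_le v; split_ifs <;> omega
    · rw [h3, H.size, List.countP_eq_length_filter,
        ← List.toFinset_card_of_nodup ((hL p).1.filter _), ← Finset.card_sdiff_of_subset]
      · congr 1
        ext v
        simp only [Finset.mem_sdiff, Finset.mem_filter, Finset.mem_univ, true_and,
          List.mem_toFinset, List.mem_filter, decide_eq_true_eq, (hL p).2, hz, hp, false_or]
        tauto
      · intro v hv
        simp at hv
        simp [hv]
    · obtain ⟨w, hw⟩ := hp'
      exact ⟨w, (hz w).2 ⟨hw.1, .inr hw.2⟩⟩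

theorem Far.visit (hL : IsAdjLists G L) (H : SearchInv G u a h) (hF : Far G u S a) (p : Fin n) :
    Far G u S (a.visit (L p)) := fun x hx => hF x ((H.mark_visit_eq_zero hL p x).1 hx).1

/-- When no unprocessed queued vertex is left at level ℓ, every vertex at level ℓ + 1 has a
processed neighbour at level ℓ and is therefore queued. -/
theorem BreadthFirst.succ {ℓ : ℕ} (hB : BreadthFirst G u S a h ℓ)
    (h0 : ∀ v ∈ a.queue.drop h, ℓ + 1 ≤ G.dist u v) :
    BreadthFirst G u S a h (ℓ + 1) where
  mem_queue v hv := by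
    rcases Nat.lt_or_ge ℓ (G.dist u v) with hlt | hle
    · obtain ⟨w, hw, hd⟩ := exists_adj_dist_eq (show G.dist u v = ℓ + 1 by omega)
      have hwq := hB.mem_queue w hd.le
      rw [← List.take_append_drop h a.queue, List.mem_append] at hwq
      rcases hwq with hwq | hwq
      · exact hB.adj w hwq v hw
      · have := h0 w hwq; omega
    · exact hB.mem_queue v hle
  le_dist := h0
  dist_le v hv := (hB.dist_le v hv).trans (by omega)
  sorted := hB.sorted
  adj := hB.adj
  removed := hB.removed
  notMem := hB.notMem

theorem BreadthFirst.visit (hG : G.Preconnected) (hL : IsAdjLists G L)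
    (hW : Set.univ ≠ S ∪ G.closedNbhd u) (H : SearchInv G u a h)
    (hlt : h < a.queue.length) (hF : ∃ ℓ, BreadthFirst G u S a h ℓ) :
    Far G u S (a.visit (L a.queue[h])) ∨
      ∃ ℓ, BreadthFirst G u S (a.visit (L a.queue[h])) (h + 1) ℓ := by
  have hdrop : a.queue.drop h = a.queue[h] :: a.queue.drop (h + 1) :=
    List.drop_eq_getElem_cons hlt
  -- Raise the level if necessary, so that ℓ is the distance of the vertex being processed.
  obtain ⟨ℓ, hB, hℓ⟩ : ∃ ℓ, BreadthFirst G u S a h ℓ ∧ G.dist u a.queue[h] = ℓ := by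
    obtain ⟨ℓ, hB⟩ := hF
    have h1 := hB.le_dist a.queue[h] (by rw [hdrop]; exact List.mem_cons_self)
    have h2 := hB.dist_le a.queue[h] (List.getElem_mem hlt)
    rcases h1.eq_or_lt with h3 | h3
    · exact ⟨ℓ, hB, h3.symm⟩
    · refine ⟨ℓ + 1, hB.succ ?_, by omega⟩
      have hs := hB.sorted
      rw [hdrop, List.pairwise_cons] at hs
      intro v hv
      rw [hdrop, List.mem_cons] at hv
      rcases hv with rfl | hv
      · exact h3
      · exact Nat.le_trans h3 (hs.1 v hv)
  have hz := H.mark_visit_eq_zero hL a.queue[h]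
  have htake := take_visit hL H hlt
  set p := a.queue[h]
  have hX : ∀ x, a.mark x = 0 → ℓ < G.dist u x := by
    intro x hx
    by_contra hcon
    have := (H.mem_queue x).1 (hB.mem_queue x (by omega))
    omega
  by_cases hp : ∀ w, a.mark w = 0 → G.Adj p w
  · left
    have hd : ∀ w, w ∉ S ∪ G.closedNbhd u → G.dist u w ≤ ℓ + 1 := by
      intro w hw
      by_cases hw0 : a.mark w = 0
      · rw [← hℓ]; exact (hp w hw0).dist_le_succ hG
      · exact hB.dist_le w (hB.removed w (fun h => hw (.inl h)) hw0)
    obtain ⟨w, hw⟩ : ∃ w, w ∉ S ∪ G.closedNbhd u := by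
      by_contra hcon
      push Not at hcon
      exact hW (Set.eq_univ_of_forall hcon).symm
    -- Since `w` is outside N[u], ℓ + 1 ≥ 2; hence the candidates, being farther than ℓ, are outside
    -- N[u] too.
    have hw2 : 2 ≤ G.dist u w := by
      have hw' := notMem_closedNbhd.1 fun h => hw (.inr h)
      exact (hG u w).one_lt_dist_of_ne_of_not_adj hw'.1.symm hw'.2
    intro x hx
    have hx0 := ((hz x).1 hx).1
    have hx1 := hX x hx0
    refine ⟨?_, fun w hw => (hd w hw).trans hx1⟩
    rintro (hxS | hxN)
    · exact hB.notMem x hx0 hxS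
    · have := hd w hw
      rcases hxN with rfl | hxN
      · simp at hx1
      · have := dist_eq_one_iff_adj.2 hxN
        omega
  · right
    obtain ⟨h1, h2, -⟩ := visit_of_exists hL H.size H.mark_le p (by simpa using hp)
    have hmem : ∀ v, v ∈ (a.visit (L p)).queue ↔ v ∈ a.queue ∨ G.Adj p v := by
      intro v
      rw [h2, List.mem_append, List.mem_filter, (hL p).2, H.mem_queue]
      simp only [ne_eq, decide_not, Bool.not_eq_true', decide_eq_false_iff_not]
      tauto
    have hdrop' : (a.visit (L p)).queue.drop (h + 1) =
        a.queue.drop (h + 1) ++ (L p).filter (a.mark · ≠ 2) := by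
      rw [h2, List.drop_append_of_le_length (by omega)]
    have hsub : ∀ v ∈ a.queue.drop (h + 1), v ∈ a.queue.drop h := fun v hv => by
      rw [hdrop]; exact List.mem_cons_of_mem _ hv
    have hnew : ∀ v ∈ (L p).filter (a.mark · ≠ 2), G.dist u v = ℓ + 1 := by
      intro v hv
      simp only [List.mem_filter, (hL p).2, decide_eq_true_eq, ne_eq] at hv
      have k1 := hv.1.dist_le_succ hG (u := u)
      have k2 : ¬ G.dist u v ≤ ℓ := fun hle => hv.2 ((H.mem_queue v).1 (hB.mem_queue v hle))
      omega
    refine ⟨ℓ, fun v hv => (hmem v).2 (.inl (hB.mem_queue v hv)), fun v hv => ?_, fun v hv => ?_,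
      ?_, fun q hq r hr => ?_, fun w hw hw0 => ?_, fun w hw => hB.notMem w ((hz w).1 hw).1⟩
    · rw [hdrop', List.mem_append] at hv
      rcases hv with hv | hv
      · exact hB.le_dist v (hsub v hv)
      · rw [hnew v hv]; omega
    · rcases (hmem v).1 hv with hv | hv
      · exact hB.dist_le v hv
      · rw [← hℓ]; exact hv.dist_le_succ hG
    · have hs := hB.sorted
      rw [hdrop, List.pairwise_cons] at hs
      rw [hdrop', List.pairwise_append]
      refine ⟨hs.2, List.pairwise_of_forall_mem_list fun v hv w hw => ?_, fun v hv w hw => ?_⟩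
      · rw [hnew v hv, hnew w hw]
      · rw [hnew w hw]; exact hB.dist_le v (List.mem_of_mem_drop hv)
    · rw [htake, List.mem_append, List.mem_singleton] at hq
      rcases hq with hq | rfl
      · exact (hmem r).2 (.inl (hB.adj q hq r hr))
      · exact (hmem r).2 (.inr hr)
    · rw [hmem]
      by_cases hw1 : a.mark w = 0
      · right
        by_contra hcon
        exact hw0 ((hz w).2 ⟨hw1, .inr hcon⟩)
      · exact .inl (hB.removed w hw hw1)

/-- An exhausted queue would be closed under adjacency, hence contain all vertices, but a candidate
is never queued. -/
theorem BreadthFirst.false {ℓ : ℕ} (hG : G.Preconnected) (H : SearchInv G u a h)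
    (hB : BreadthFirst G u S a h ℓ) (hle : a.queue.length ≤ h) : False := by
  obtain ⟨x, hx⟩ := H.nonempty
  have := mem_of_preconnected hG (A := {v | v ∈ a.queue}) (hB.mem_queue u (by simp))
    (fun p hp q hq => hB.adj p (by rwa [List.take_of_length_le hle]) q hq) x
  rw [Set.mem_ofPred_eq, H.mem_queue] at this
  omega

end Ram

namespace Ram
open SimpleGraph
variable {n : ℕ} {G : SimpleGraph (Fin n)} {L : Fin n → List (Fin n)} {u : Fin n}
  {S : Set (Fin n)} {a : State n} {h : ℕ}

/-- The number of steps needed for the unprocessed vertices. -/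
def remainingSteps (L : Fin n → List (Fin n)) (a : State n) (h : ℕ) : ℕ :=
  ∑ v ∈ (a.queue.take h).toFinsetᶜ, (21 * (L v).length + 17)

theorem remainingSteps_visit (hL : IsAdjLists G L) (H : SearchInv G u a h)
    (hlt : h < a.queue.length) :
    21 * (L a.queue[h]).length + 17 + remainingSteps L (a.visit (L a.queue[h])) (h + 1) ≤
      remainingSteps L a h := by
  have hm := H.getElem_notMem_take hlt
  rw [remainingSteps, remainingSteps, take_visit hL H hlt, ← Finset.add_sum_erase
    (a.queue.take h).toFinsetᶜ (fun v => 21 * (L v).length + 17) (a := a.queue[h])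
    (by simpa using hm)]
  refine Nat.add_le_add_left (Finset.sum_le_sum_of_subset fun v hv => ?_) _
  simpa only [Finset.mem_compl, List.mem_toFinset, List.mem_append, List.mem_singleton,
    Finset.mem_erase, not_or, and_comm] using hv

/-- The degrees add up to 2m, whence 42 = 2 · 21. -/
theorem remainingSteps_le (hL : IsAdjLists G L) :
    remainingSteps L a h ≤ 42 * G.edgeSet.ncard + 17 * n := by
  classical
  have e : ∀ v, (L v).length = G.degree v := by
    intro v
    rw [← List.toFinset_card_of_nodup (hL v).1, ← G.card_neighborFinset_eq_degree]
    congr 1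
    ext w
    simp [(hL v).2]
  refine (Finset.sum_le_sum_of_subset (Finset.subset_univ _)).trans ?_
  simp only [e]
  rw [Finset.sum_add_distrib, ← Finset.mul_sum, G.sum_degrees_eq_twice_card_edges,
    ← G.coe_edgeFinset, Set.ncard_coe_finset]
  simp
  omega

/-- The invariant of the search when `size` has its correct initial value. -/
theorem searchInv_init (hS : G.IsTransitiveSet u S) (hW : Set.univ ≠ S ∪ G.closedNbhd u)
    (ha : a.mark = (State.init u S).mark) (hq : a.queue = [u])
    (hs : a.size = (Finset.univ.filter (a.mark · = 0)).card) : SearchInv G u a 0 := by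
  have h0 : ∀ v, a.mark v = 0 ↔ v ≠ u ∧ v ∉ S := by
    intro v
    simp only [ha, State.init]
    split_ifs <;> simp_all
  refine ⟨by simp, by simp [hq], fun v => ?_, fun v => ?_, hs, ?_, fun w hw x hx => ?_, by simp⟩
  · simp only [hq, ha, State.init, List.mem_singleton]
    split_ifs <;> simp_all
  · simp only [ha, State.init]
    split_ifs <;> simp
  · by_contra hcon
    push Not at hcon
    refine hW (Set.eq_univ_of_forall fun v => ?_).symm
    have := hcon v
    rw [ne_eq, h0, not_and_or, not_not, not_not] at this
    rcases this with rfl | hv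
    · exact .inr (.inl rfl)
    · exact .inl hv
  · exact (h0 x).2 ⟨hx.ne, hS.notMem_of_hidden hx ((h0 w).1 hw).2⟩

theorem breadthFirst_init (hG : G.Preconnected)
    (ha : a.mark = (State.init u S).mark) (hq : a.queue = [u]) : BreadthFirst G u S a 0 0 := by
  refine ⟨fun v hv => ?_, by simp, by simp [hq], by simp [hq], by simp, fun w hw hw0 => ?_,
    fun w hw => ?_⟩
  · rw [hq, List.mem_singleton]
    exact ((hG u v).dist_eq_zero_iff.1 (by omega)).symm
  · simp only [ha, State.init] at hw0
    rw [hq, List.mem_singleton]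
    split_ifs at hw0 <;> simp_all
  · simp only [ha, State.init] at hw
    split_ifs at hw
    simp_all

/-- Put all vertices with mark `1` on the queue. -/
def State.pushAll (a : State n) : State n := (List.finRange n).foldl State.pushStep a

theorem State.mark_pushAll (a : State n) (v : Fin n) :
    a.pushAll.mark v = if a.mark v = 1 then 2 else a.mark v := by
  simp [pushAll, foldl_pushStep (List.nodup_finRange n)]

theorem State.mark_pushAll_eq_zero (a : State n) (v : Fin n) :
    a.pushAll.mark v = 0 ↔ a.mark v = 0 := by
  rw [mark_pushAll]
  split_ifs with hv <;> simp [hv]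

/-- Vertices are only appended, so the candidates and the processed part of the queue stay the same.
-/
theorem SearchInv.pushAll (H : SearchInv G u a h) : SearchInv G u a.pushAll h := by
  have hz := a.mark_pushAll_eq_zero
  have hq : a.pushAll.queue = a.queue ++ (List.finRange n).filter (a.mark · = 1) := by
    simp [State.pushAll, foldl_pushStep (List.nodup_finRange n)]
  have hs : a.pushAll.size = a.size := by
    simp [State.pushAll, foldl_pushStep (List.nodup_finRange n)]
  refine ⟨?_, ?_, fun v => ?_, fun v => ?_, ?_, ?_, ?_, ?_⟩
  · rw [hq, List.length_append]; exact H.le.trans (by omega)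
  · rw [hq]
    refine H.nodup.append ((List.nodup_finRange n).filter _) fun v hv hv' => ?_
    have := (H.mem_queue v).1 hv
    simp at hv'
    omega
  · rw [hq, List.mem_append, H.mem_queue, a.mark_pushAll]
    split_ifs with hv <;> simp [hv]
  · rw [a.mark_pushAll]
    have := H.mark_le v
    split_ifs <;> omega
  · rw [hs, H.size]; simp only [hz]
  · simpa only [hz] using H.nonempty
  · simpa only [hz] using H.closed
  · rw [hq, List.take_append_of_le_length H.le]
    simpa only [hz] using H.uniform

theorem SearchInv.exists_unique (hP : G.IsPrimeGraph) (H : SearchInv G u a h)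
    (hh : a.queue.length ≤ h) (h1 : ∀ v, a.mark v ≠ 1) (hu : a.mark u ≠ 0) :
    ∃ v, ∀ w, a.mark w = 0 ↔ w = v := by
  -- With no mark 1 left and the queue exhausted, each vertex outside the candidate set is
  -- processed, hence adjacent to all candidates or to none.
  have hm : G.IsModuleSet {v | a.mark v = 0} := by
    intro x hx y hy
    have key : ∀ x y z, a.mark x = 0 → a.mark y = 0 → a.mark z ≠ 0 → G.Adj x z → G.Adj y z := by
      intro x y z hx hy hz hxz
      have hzq : z ∈ a.queue := by
        rw [H.mem_queue]
        have := H.mark_le z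
        have := h1 z
        omega
      rcases H.uniform z (by rwa [List.take_of_length_le hh]) with h | h
      · exact (h y hy).symm
      · exact absurd hxz.symm (h x hx)
    ext z
    exact ⟨fun h => ⟨key x y z hx hy h.2 h.1, h.2⟩, fun h => ⟨key y x z hy hx h.2 h.1, h.2⟩⟩
  rcases hP _ hm with h | h | ⟨v, h⟩
  · obtain ⟨w, hw⟩ := H.nonempty
    exact absurd hw (Set.eq_empty_iff_forall_notMem.1 h w)
  · exact absurd (Set.eq_univ_iff_forall.1 h u) hu
  · exact ⟨v, fun w => by simpa using Set.ext_iff.1 h w⟩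

theorem SearchInv.isExtremity (H : SearchInv G u a h) {v : Fin n}
    (hv : ∀ w, a.mark w = 0 ↔ w = v) (huv : v ∉ G.closedNbhd u) : G.IsExtremity v := by
  have hu : u ∈ (G.closedNbhd v)ᶜ := by
    have := notMem_closedNbhd.1 huv
    exact notMem_closedNbhd.2 ⟨this.1.symm, fun h => this.2 h.symm⟩
  have key : ∀ x : ((G.closedNbhd v)ᶜ : Set (Fin n)),
      (G.induce (G.closedNbhd v)ᶜ).Reachable x ⟨u, hu⟩ := by
    rintro ⟨x, hx⟩
    by_contra hcon
    exact (notMem_closedNbhd.1 hx).1 ((hv x).1 (H.closed v ((hv v).2 rfl) x ⟨hx, hu, hcon⟩))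
  exact fun x y => (key x).trans (key y).symm

theorem halts_mainProg (hn : 3 ≤ n) (hP : G.IsPrimeGraph) (hL : IsAdjLists G L)
    (hS : G.IsTransitiveSet u S) (hW : Set.univ ≠ S ∪ G.closedNbhd u) :
    Halts mainProg (input L u S) (84 * (n + G.edgeSet.ncard)) fun s => ∃ v : Fin n,
      s.reg 0 = v ∧ v ∉ S ∪ G.closedNbhd u ∧ G.IsExtremity v ∧
        ∀ w : Fin n, w ∉ S ∪ G.closedNbhd u → G.dist u w ≤ G.dist u v := by
  have hG : G.Preconnected := hP.preconnected (by simpa using hn)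
  set N := 42 * G.edgeSet.ncard + 17 * n with hN
  -- Two searches and three passes over the vertices take 84m + 51n steps up to an additive
  -- constant, which n ≥ 3 absorbs.
  have hT : ((3 + 2) * n + 2) + (((N + 1) + (((5 + 2) * n + 2) + ((N + 1) +
      (((3 + 2) * n + 2) + 1)))) + 1) + 1 + 1 + 1 + 1 + 1 ≤ 84 * (n + G.edgeSet.ncard) := by
    omega
  refine Halts.mono (.op_seq (.op_seq (.op_seq (.op_seq (.op_seq (.seq
    (((implements_count L).forVertices (rep_init L u S)).mono le_rfl ?_))))))) hT fun _ h => h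
  rintro s₁ ⟨h1, h12⟩
  rw [foldl_countStep] at h1
  set a₀ : State n := { State.init u S with
    size := (List.finRange n).countP ((State.init u S).mark · = 0)
    count := (List.finRange n).countP ((State.init u S).mark · = 0) } with ha₀
  have h2 : Rep L a₀ (Op.apply (.copy 4 5) s₁) := by
    constructor <;> simp [Op.apply, Mem.setReg, h1.reg_zero, h1.reg_const_zero, h1.reg_const_one,
      h1.reg_const_two, h1.adj, h1.mark, h1.length, h1.count, ha₀, State.init] <;>
    first | exact h1.offset | exact h1.queue 0 (by simp [State.init])
  have h22 : (Op.apply (.copy 4 5) s₁).reg 2 = 0 := by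
    simp [Op.apply, Mem.setReg, h12, Mem.setArr, input]
  have hI₀ : SearchInv G u a₀ 0 := by
    refine searchInv_init hS hW rfl rfl ?_
    rw [ha₀]
    simp only
    rw [List.countP_eq_length_filter, ← List.toFinset_card_of_nodup
      ((List.nodup_finRange n).filter _)]
    congr 1
    ext v
    simp
  refine .op_seq (.seq ((halts_searchProg (fun a h => SearchInv G u a h ∧ a.mark u = 2 ∧
      (Far G u S a ∨ ∃ ℓ, BreadthFirst G u S a h ℓ)) (remainingSteps L)
    ?_ N h2 ?_ (remainingSteps_le hL)).mono le_rfl ?_))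
  · rintro a h ⟨hI, hu, hF⟩ hlt
    refine ⟨⟨hI.visit hL hlt, hI.mark_visit_eq_two hL _ hu, ?_⟩, remainingSteps_visit hL hI hlt⟩
    rcases hF with hF | hF
    · exact .inl (hF.visit hL hI _)
    · exact BreadthFirst.visit hG hL hW hI hlt hF
  · rw [h22]
    exact ⟨hI₀, by simp [ha₀, State.init], .inr ⟨0, breadthFirst_init hG rfl rfl⟩⟩
  rintro s₃ ⟨a, h3, ⟨hI, hu, hF⟩, hle⟩
  -- The first search cannot end while still breadth-first, so some processed vertex was adjacent to
  -- all candidates.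
  replace hF : Far G u S a := hF.resolve_right fun ⟨ℓ, hB⟩ => hB.false hG hI hle
  refine .seq (((implements_push L).forVertices h3).mono le_rfl ?_)
  rintro s₄ ⟨h4, h42⟩
  refine .seq ((halts_searchProg (fun a h => SearchInv G u a h ∧ a.mark u = 2 ∧
      Far G u S a ∧ ∀ v, a.mark v ≠ 1) (remainingSteps L)
    ?_ N h4 ?_ (remainingSteps_le hL)).mono le_rfl ?_)
  · rintro a h ⟨hI, hu, hF, h1⟩ hlt
    exact ⟨⟨hI.visit hL hlt, hI.mark_visit_eq_two hL _ hu, hF.visit hL hI _,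
      hI.mark_visit_ne_one hL _ h1⟩, remainingSteps_visit hL hI hlt⟩
  · rw [h42]
    refine ⟨hI.pushAll, ?_, fun x hx => hF x ((a.mark_pushAll_eq_zero x).1 hx), fun v => ?_⟩
    · exact (a.mark_pushAll u).trans (by simp [hu])
    · refine ne_of_eq_of_ne (a.mark_pushAll v) ?_
      split_ifs with hv
      · simp
      · exact hv
  rintro s₅ ⟨b, h5, ⟨hI', hu', hF', h1'⟩, hle'⟩
  refine .seq (((implements_find L).forVertices h5).mono le_rfl ?_)
  rintro s₆ ⟨h6, -⟩
  obtain ⟨v, hv⟩ := hI'.exists_unique hP hle' h1' (by omega)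
  have hFv := hF' v ((hv v).2 rfl)
  refine .op ⟨v, ?_, hFv.1, hI'.isExtremity hv fun h => hFv.1 (.inr h), hFv.2⟩
  simp [Op.apply, Mem.setReg, h6.count, foldl_findStep b (List.mem_finRange v) hv]

end Ram

/-- There are one program and one constant `C` such that, on every prime graph `G` with `n ≥ 3`
vertices and `m` edges, every vertex `u` and every `u`-transitive set `S` with `S ∪ N[u] ≠ V`, the
program halts within `C * (n + m)` steps with, in register `0`, an extremity `v ∉ S ∪ N[u]` whose
distance to `u` is maximum among all vertices outside of `S ∪ N[u]`. -/
theorem mainTheorem8 :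
    ∃ (P : Ram.Prog) (C : ℕ),
      ∀ (n : ℕ) (G : SimpleGraph (Fin n)) (L : Fin n → List (Fin n)) (u : Fin n)
        (S : Set (Fin n)),
        3 ≤ n → G.IsPrimeGraph → Ram.IsAdjLists G L → G.IsTransitiveSet u S →
        Set.univ ≠ S ∪ G.closedNbhd u →
        ∃ (s : Ram.Mem) (t : ℕ) (v : Fin n),
          Ram.Exec P (Ram.input L u S) s t ∧
          t ≤ C * (n + G.edgeSet.ncard) ∧
          s.reg 0 = (v : ℕ) ∧
          v ∉ S ∪ G.closedNbhd u ∧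
          G.IsExtremity v ∧
          ∀ w : Fin n, w ∉ S ∪ G.closedNbhd u → G.dist u w ≤ G.dist u v := by
  refine ⟨Ram.mainProg, 84, fun n G L u S hn hP hL hS hW => ?_⟩
  obtain ⟨s, t, h1, h2, v, h3⟩ := Ram.halts_mainProg hn hP hL hS hW
  exact ⟨s, t, v, h1, h2, h3⟩
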